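/- Let $\mathbb T=\{z\in\mathbb C:|z|=1\}$ with normalized Lebesgue measure $\boldsymbol m$. Let $w\ge 0$ be a $C^\infty$ function on $\mathbb R$ with $\operatorname{supp} w\subset[\frac12,2]$ and $\sum_{n\in\mathbb Z}w(2^nx)=1$ for $x>0$. Put $W_0(z)=\bar z+1+z$, $W_n(z)=\sum_{k\in\mathbb Z}w(k/2^n)z^k$ for $n\ge1$, and $W_n^\#=\overline{W_n}$. The Besov class $B^2_{\infty1}$ consists of the functions $\varphi\in L^1(\mathbb T)$ with $$\sum_{n\ge0}2^{2n}\|\varphi*W_n\|_{L^\infty}<\infty\quad\text{and}\quad\sum_{n\ge1}2^{2n}\|\varphi*W_n^\#\|_{L^\infty}<\infty .$$ For a function $\varphi$ on $\mathbb T$, the divided differences are $$(\mathfrak D\varphi)(z_1,z_2)=\frac{\varphi(z_1)-\varphi(z_2)}{z_1-z_2},\qquad (\mathfrak D^2\varphi)(z_1,z_2,z_3)=\frac{(\mathfrak D\varphi)(z_1,z_2)-(\mathfrak D\varphi)(z_2,z_3)}{z_1-z_3},$$ where, if $z_1=z_2$ (respectively $z_1=z_3$), the quotient is understood as its limit as $z_2\to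 z_1$ (respectively $z_3\to z_1$) along $\mathbb T$. **Theorem.** Let $\varphi\in B^2_{\infty1}$. Then $\varphi$ coincides almost everywhere with a continuous function on $\mathbb T$ (with which we identify it) for which all the limits above exist, and $$\mathfrak D^2\varphi\in C(\mathbb T)\hat\otimes C(\mathbb T)\hat\otimes C(\mathbb T),$$ that is, there are $f_n,g_n,h_n\in C(\mathbb T)$, $n\ge0$, such that $\sum_{n\ge0}\|f_n\|_\infty\|g_n\|_\infty\|h_n\|_\infty<\infty$ and $$(\mathfrak D^2\varphi)(z_1,z_2,z_3)=\sum_{n\ge0}f_n(z_1)g_n(z_2)h_n(z_3)\qquad\text{for all }z_1,z_2,z_3\in\mathbb T .$$ -/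

import Mathlib

open MeasureTheory Filter Topology
open scoped ENNReal ContDiff ComplexConjugate

namespace BesovCircle

noncomputable section

/-- The Borel σ-algebra on the unit circle `𝕋 = {z ∈ ℂ : |z| = 1}`. -/
instance instMeasurableSpaceCircle : MeasurableSpace Circle := borel Circle

instance instBorelSpaceCircle : BorelSpace Circle := ⟨rfl⟩

/-- Normalized Lebesgue measure on `𝕋`: the image of the normalized Haar measure of `ℝ / ℤ`
under `x ↦ e^{2πix}`. -/
def arcMeasure : Measure Circle :=
  Measure.map (AddCircle.toCircle : UnitAddCircle → Circle) AddCircle.haarAddCircle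

instance instIsProbabilityMeasureArcMeasure : IsProbabilityMeasure arcMeasure :=
  Measure.isProbabilityMeasure_map AddCircle.continuous_toCircle.measurable.aemeasurable

/-- The admissible generators `w` of the dyadic decomposition: `w ∈ C^∞(ℝ)`, `w ≥ 0`,
`supp w ⊆ [1/2, 2]`, and `∑_{n ∈ ℤ} w (2^n x) = 1` for every `x > 0`. -/
structure IsDyadicCutoff (w : ℝ → ℝ) : Prop where
  smooth : ContDiff ℝ ∞ w
  nonneg : ∀ x, 0 ≤ w x
  support_subset : tsupport w ⊆ Set.Icc (1 / 2) 2
  sum_eq_one : ∀ x : ℝ, 0 < x → HasSum (fun n : ℤ => w ((2 : ℝ) ^ n * x)) 1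

/-- The trigonometric polynomials `W_0(z) = z̄ + 1 + z` and, for `n ≥ 1`,
`W_n(z) = ∑_{k ∈ ℤ} w(k / 2^n) z^k` (only finitely many terms are nonzero). -/
def dyadicKernel (w : ℝ → ℝ) (n : ℕ) (z : Circle) : ℂ :=
  if n = 0 then conj (z : ℂ) + 1 + (z : ℂ)
  else ∑' k : ℤ, ((w ((k : ℝ) / 2 ^ n) : ℝ) : ℂ) * (z : ℂ) ^ k

/-- `W_n^#(z)`, the complex conjugate of `W_n(z)`. -/
def dyadicKernelSharp (w : ℝ → ℝ) (n : ℕ) (z : Circle) : ℂ :=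
  conj (dyadicKernel w n z)

/-- The convolution `(φ * K)(z) = ∫_𝕋 φ(τ) K(z τ⁻¹) dm(τ)` on the circle. -/
def circleConv (φ K : Circle → ℂ) (z : Circle) : ℂ :=
  ∫ τ, φ τ * K (z * τ⁻¹) ∂arcMeasure

/-- Membership of a function `φ` on `𝕋` in the Besov class `B^s_{∞1}`, for an integer smoothness
`s ≥ 1`: `φ` is integrable and the sequences `(2^{ns} ‖φ * W_n‖_{L^∞})_{n ≥ 0}` and
`(2^{ns} ‖φ * W_n^#‖_{L^∞})_{n ≥ 1}` belong to `ℓ¹`. -/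
structure MemBesov (w : ℝ → ℝ) (s : ℕ) (φ : Circle → ℂ) : Prop where
  integrable : Integrable φ arcMeasure
  sum_lt_top :
    ∑' n : ℕ, (2 : ℝ≥0∞) ^ (n * s) *
      eLpNorm (circleConv φ (dyadicKernel w n)) ⊤ arcMeasure < ⊤
  sum_sharp_lt_top :
    ∑' n : ℕ, (2 : ℝ≥0∞) ^ ((n + 1) * s) *
      eLpNorm (circleConv φ (dyadicKernelSharp w (n + 1))) ⊤ arcMeasure < ⊤

/-- `D` is the first divided difference `𝔇φ` of `φ`: it is the difference quotient off the
diagonal, and on the diagonal it is the limit of the difference quotients, which exists (this is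
the derivative of `φ` along the circle with respect to the complex variable). -/
structure IsDividedDifference₁ (φ : Circle → ℂ) (D : Circle → Circle → ℂ) : Prop where
  off_diag : ∀ z₁ z₂ : Circle, z₁ ≠ z₂ → D z₁ z₂ = (φ z₁ - φ z₂) / ((z₁ : ℂ) - (z₂ : ℂ))
  diag : ∀ z : Circle,
    Tendsto (fun u : Circle => (φ z - φ u) / ((z : ℂ) - (u : ℂ))) (𝓝[≠] z) (𝓝 (D z z))

/-- `Ψ` is the second divided difference `𝔇²φ` of `φ`: with `D = 𝔇φ`,
`Ψ(z₁, z₂, z₃) = (D(z₁, z₂) - D(z₂, z₃)) / (z₁ - z₃)` if `z₁ ≠ z₃`, and for `z₁ = z₃` it is the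
limit of these quotients as the third variable tends to `z₁`, which exists. Such a `Ψ` is unique
if it exists. -/
def IsDividedDifference₂ (φ : Circle → ℂ) (Ψ : Circle → Circle → Circle → ℂ) : Prop :=
  ∃ D : Circle → Circle → ℂ, IsDividedDifference₁ φ D ∧
    (∀ z₁ z₂ z₃ : Circle, z₁ ≠ z₃ →
      Ψ z₁ z₂ z₃ = (D z₁ z₂ - D z₂ z₃) / ((z₁ : ℂ) - (z₃ : ℂ))) ∧
    (∀ z₁ z₂ : Circle,
      Tendsto (fun u : Circle => (D z₁ z₂ - D z₂ u) / ((z₁ : ℂ) - (u : ℂ)))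
        (𝓝[≠] z₁) (𝓝 (Ψ z₁ z₂ z₁)))

/-- Membership in the projective tensor product `C(𝕋) ⊗̂ C(𝕋) ⊗̂ C(𝕋)`: `Ψ` admits a representation
`Ψ(z₁, z₂, z₃) = ∑_n f_n(z₁) g_n(z₂) h_n(z₃)` with continuous `f_n, g_n, h_n` on `𝕋` and
`∑_n ‖f_n‖ ‖g_n‖ ‖h_n‖ < ∞` (sup norms). -/
def MemProjectiveTensor₃ (Ψ : Circle → Circle → Circle → ℂ) : Prop :=
  ∃ f g h : ℕ → C(Circle, ℂ),
    Summable (fun n => ‖f n‖ * ‖g n‖ * ‖h n‖) ∧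
      ∀ z₁ z₂ z₃ : Circle, HasSum (fun n => f n z₁ * g n z₂ * h n z₃) (Ψ z₁ z₂ z₃)

end

end BesovCircle

/-! Split `φ` into its mean and the dyadic pieces with frequencies `±m`, `m ~ 2^n`. It suffices that
the second divided difference of a piece `f` at level `n` has projective norm at most `48 * 4^n *
‖f‖`: the Besov condition is exactly the summability of these bounds.

For `f = ∑ a_m z^m`, `𝔇²f` is the Hankel form `∑ a_{i+j+k+2} x^i y^j z^k`; for negative frequencies
it is the same form with shift `1`, in the inverse variables and with weight `(xyz)⁻¹`. Where
`a_{i+j+k+c} ≠ 0`, one index is at least about `2^n / 8`. With a ramp `h` equal to `1` there, `1 =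
h_i + (1 - h_i) h_j + (1 - h_i)(1 - h_j) h_k` on the support. In each part, fix the two indices
other than the one carrying the plain factor `h` and sum over that one. This leaves `O(4^n)`
elementary tensors, two of whose factors are weighted monomials (`projTensorBound_hankelForm`).

The third factor is `∑ h_i a_{i+s} z^i`. A sharp cut of the frequencies below `s` could cost a
logarithm in sup norm; the ramp makes the cost an absolute constant (`norm_sum_ramp_mul_le`). The
series of pieces converges uniformly with both divided differences (`HasDivDiffBound.tsum`), and its
sum has the Fourier coefficients of `φ`, hence equals `φ` almost everywhere. -/

namespace BesovCircle

/-! ### Projective tensor norm bounds -/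

/-- `Ψ` has a representation in `C(𝕋) ⊗̂ C(𝕋) ⊗̂ C(𝕋)`, indexed by some countable type, of
total norm at most `C`. -/
def ProjTensorBound (Ψ : Circle → Circle → Circle → ℂ) (C : ℝ) : Prop :=
  ∃ (ι : Type) (_ : Countable ι) (f g h : ι → C(Circle, ℂ)) (S : ℝ),
    HasSum (fun i => ‖f i‖ * ‖g i‖ * ‖h i‖) S ∧ S ≤ C ∧
      ∀ z₁ z₂ z₃ : Circle, HasSum (fun i => f i z₁ * g i z₂ * h i z₃) (Ψ z₁ z₂ z₃)

namespace ProjTensorBound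

variable {Ψ Φ : Circle → Circle → Circle → ℂ} {C C' : ℝ}

theorem norm_mul_apply_le (f g h : C(Circle, ℂ)) (z₁ z₂ z₃ : Circle) :
    ‖f z₁ * g z₂ * h z₃‖ ≤ ‖f‖ * ‖g‖ * ‖h‖ := by
  rw [norm_mul, norm_mul]
  gcongr <;> exact ContinuousMap.norm_coe_le_norm _ _

theorem mono (hΨ : ProjTensorBound Ψ C) (h : C ≤ C') : ProjTensorBound Ψ C' := by
  obtain ⟨ι, hι, f, g, k, S, h1, h2, h3⟩ := hΨ
  exact ⟨ι, hι, f, g, k, S, h1, h2.trans h, h3⟩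

theorem norm_le (hΨ : ProjTensorBound Ψ C) (z₁ z₂ z₃ : Circle) : ‖Ψ z₁ z₂ z₃‖ ≤ C := by
  obtain ⟨ι, hι, f, g, k, S, h1, h2, h3⟩ := hΨ
  rw [← (h3 z₁ z₂ z₃).tsum_eq]
  exact (tsum_of_norm_bounded h1 fun i => norm_mul_apply_le _ _ _ _ _ _).trans h2

theorem continuous (hΨ : ProjTensorBound Ψ C) (z₁ z₂ : Circle) : Continuous (Ψ z₁ z₂) := by
  obtain ⟨ι, hι, f, g, k, S, h1, h2, h3⟩ := hΨ
  have : Ψ z₁ z₂ = fun z₃ => ∑' i, f i z₁ * g i z₂ * k i z₃ :=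
    funext fun z₃ => (h3 z₁ z₂ z₃).tsum_eq.symm
  rw [this]
  exact continuous_tsum (fun i => by fun_prop) h1.summable
    fun i z => norm_mul_apply_le _ _ _ _ _ _

theorem zero : ProjTensorBound (fun _ _ _ => 0) 0 :=
  ⟨Empty, inferInstance, fun _ => 0, fun _ => 0, fun _ => 0, 0, hasSum_empty, le_rfl,
    fun _ _ _ => hasSum_empty⟩

theorem pure (f g h : C(Circle, ℂ)) :
    ProjTensorBound (fun z₁ z₂ z₃ => f z₁ * g z₂ * h z₃) (‖f‖ * ‖g‖ * ‖h‖) :=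
  ⟨Unit, inferInstance, fun _ => f, fun _ => g, fun _ => h, _, hasSum_unique _, le_rfl,
    fun _ _ _ => hasSum_unique _⟩

theorem tsum {κ : Type} [Countable κ] {Ψ : κ → Circle → Circle → Circle → ℂ} {C : κ → ℝ}
    (hΨ : ∀ n, ProjTensorBound (Ψ n) (C n)) (hC : Summable C) :
    ProjTensorBound (fun z₁ z₂ z₃ => ∑' n, Ψ n z₁ z₂ z₃) (∑' n, C n) := by
  choose ι hι f g h S h1 h2 h3 using hΨ
  have hS0 : ∀ n, 0 ≤ S n := fun n => (h1 n).nonneg fun i => by positivity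
  have hS : Summable S := Summable.of_nonneg_of_le hS0 h2 hC
  have hsum : Summable fun p : Σ n, ι n => ‖f p.1 p.2‖ * ‖g p.1 p.2‖ * ‖h p.1 p.2‖ := by
    rw [summable_sigma_of_nonneg fun p => by positivity]
    exact ⟨fun n => (h1 n).summable, by simpa only [fun n => (h1 n).tsum_eq] using hS⟩
  refine ⟨Σ n, ι n, inferInstance, fun p => f p.1 p.2, fun p => g p.1 p.2, fun p => h p.1 p.2,
    ∑' n, S n, ?_, hS.tsum_le_tsum h2 hC, fun z₁ z₂ z₃ => ?_⟩
  · rw [(hsum.hasSum.sigma h1).tsum_eq]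
    exact hsum.hasSum
  · have hs : Summable fun p : Σ n, ι n => f p.1 p.2 z₁ * g p.1 p.2 z₂ * h p.1 p.2 z₃ :=
      Summable.of_norm_bounded hsum fun p => norm_mul_apply_le _ _ _ _ _ _
    beta_reduce
    rw [(hs.hasSum.sigma fun n => h3 n z₁ z₂ z₃).tsum_eq]
    exact hs.hasSum

theorem add (hΨ : ProjTensorBound Ψ C) (hΦ : ProjTensorBound Φ C') :
    ProjTensorBound (fun z₁ z₂ z₃ => Ψ z₁ z₂ z₃ + Φ z₁ z₂ z₃) (C + C') := by
  obtain ⟨ι, hι, f, g, k, S, h1, h2, h3⟩ := hΨ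
  obtain ⟨ι', hι', f', g', k', S', h1', h2', h3'⟩ := hΦ
  exact ⟨ι ⊕ ι', inferInstance, Sum.elim f f', Sum.elim g g', Sum.elim k k', S + S',
    HasSum.sum (f := fun i => ‖Sum.elim f f' i‖ * ‖Sum.elim g g' i‖ * ‖Sum.elim k k' i‖) h1 h1',
    add_le_add h2 h2', fun z₁ z₂ z₃ => HasSum.sum
      (f := fun i => Sum.elim f f' i z₁ * Sum.elim g g' i z₂ * Sum.elim k k' i z₃)
      (h3 z₁ z₂ z₃) (h3' z₁ z₂ z₃)⟩

theorem sum {κ : Type*} (s : Finset κ) {Ψ : κ → Circle → Circle → Circle → ℂ} {C : ℝ}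
    (hΨ : ∀ n ∈ s, ProjTensorBound (Ψ n) C) :
    ProjTensorBound (fun z₁ z₂ z₃ => ∑ n ∈ s, Ψ n z₁ z₂ z₃) (s.card * C) := by
  classical
  induction s using Finset.induction_on with
  | empty => simpa using zero
  | insert a s ha ih =>
    simp only [Finset.sum_insert ha, Finset.card_insert_of_notMem ha]
    convert (hΨ a (Finset.mem_insert_self a s)).add
      (ih fun n hn => hΨ n (Finset.mem_insert_of_mem hn)) using 1
    push_cast; ring

/-- Substitution and multiplication by functions of norm at most `1` contract each factor. Needed
with `σ` the inversion and `p = z⁻¹`, to treat negative frequencies. -/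
theorem weighted_comp (hΨ : ProjTensorBound Ψ C) (p : C(Circle, ℂ)) (hp : ‖p‖ ≤ 1)
    (σ : C(Circle, Circle)) :
    ProjTensorBound
      (fun z₁ z₂ z₃ => p z₁ * p z₂ * p z₃ * Ψ (σ z₁) (σ z₂) (σ z₃)) C := by
  obtain ⟨ι, hι, f, g, k, S, h1, h2, h3⟩ := hΨ
  have key : ∀ f : C(Circle, ℂ), ‖p * f.comp σ‖ ≤ ‖f‖ := fun f => by
    refine (ContinuousMap.norm_le _ (norm_nonneg _)).2 fun z => ?_
    rw [ContinuousMap.mul_apply, norm_mul]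
    exact (mul_le_of_le_one_left (norm_nonneg _)
      ((ContinuousMap.norm_coe_le_norm p z).trans hp)).trans
      (ContinuousMap.norm_coe_le_norm f (σ z))
  have hle : ∀ i, ‖p * (f i).comp σ‖ * ‖p * (g i).comp σ‖ * ‖p * (k i).comp σ‖ ≤
      ‖f i‖ * ‖g i‖ * ‖k i‖ := fun i => by
    gcongr <;> exact key _
  have hs := Summable.of_nonneg_of_le (fun i => by positivity) hle h1.summable
  refine ⟨ι, hι, fun i => p * (f i).comp σ, fun i => p * (g i).comp σ,
    fun i => p * (k i).comp σ, _, hs.hasSum, ?_, fun z₁ z₂ z₃ => ?_⟩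
  · exact ((hs.tsum_le_tsum hle h1.summable).trans_eq h1.tsum_eq).trans h2
  · refine ((h3 (σ z₁) (σ z₂) (σ z₃)).mul_left (p z₁ * p z₂ * p z₃)).congr_fun fun i => ?_
    simp only [ContinuousMap.mul_apply, ContinuousMap.comp_apply]
    ring

/-- A countable family becomes a sequence by embedding its index type in `ℕ` and extending by zero.
-/
theorem memProjectiveTensor₃ (hΨ : ProjTensorBound Ψ C) : MemProjectiveTensor₃ Ψ := by
  obtain ⟨ι, hι, f, g, k, S, h1, h2, h3⟩ := hΨ
  obtain ⟨e, he⟩ := exists_injective_nat ι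
  refine ⟨Function.extend e f 0, Function.extend e g 0, Function.extend e k 0, ?_,
    fun z₁ z₂ z₃ => ?_⟩
  · refine (he.summable_iff fun n hn => ?_).1 (h1.summable.congr fun i => ?_)
    · simp [Function.extend_apply' _ _ _ hn]
    · simp [he.extend_apply]
  · refine (he.hasSum_iff fun n hn => ?_).1 ((h3 z₁ z₂ z₃).congr_fun fun i => ?_)
    · simp [Function.extend_apply' _ _ _ hn]
    · simp [he.extend_apply]

end ProjTensorBound

/-! ### Divided differences through cleared identities -/

/-- `f` has continuous first and second divided differences, characterised by their cleared
difference identities, and the second one has projective tensor norm at most `C`. -/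
def HasDivDiffBound (f : Circle → ℂ) (C : ℝ) : Prop :=
  ∃ (D : Circle → Circle → ℂ) (Ψ : Circle → Circle → Circle → ℂ),
    (∀ z, Continuous (D z)) ∧
    (∀ z₁ z₂ : Circle, ((z₁ : ℂ) - z₂) * D z₁ z₂ = f z₁ - f z₂) ∧
    (∀ z₁ z₂ z₃ : Circle, ((z₁ : ℂ) - z₃) * Ψ z₁ z₂ z₃ = D z₁ z₂ - D z₂ z₃) ∧
    ProjTensorBound Ψ C

theorem Circle.coe_sub_ne_zero {z u : Circle} (h : z ≠ u) : (z : ℂ) - u ≠ 0 :=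
  sub_ne_zero.2 fun h' => h (Circle.ext h')

namespace HasDivDiffBound

/-- Off the diagonal the identities can be divided; on it, continuity of `D` and `Ψ` in the last
variable supplies the required limits. -/
theorem exists_isDividedDifference₂ {f : Circle → ℂ} {C : ℝ} (hf : HasDivDiffBound f C) :
    ∃ Ψ, IsDividedDifference₂ f Ψ ∧ MemProjectiveTensor₃ Ψ := by
  obtain ⟨D, Ψ, hD, h1, h2, hΨ⟩ := hf
  have q1 : ∀ z₁ z₂ : Circle, z₁ ≠ z₂ → D z₁ z₂ = (f z₁ - f z₂) / ((z₁ : ℂ) - z₂) :=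
    fun z₁ z₂ h => by rw [← h1, mul_div_cancel_left₀ _ (Circle.coe_sub_ne_zero h)]
  have q2 : ∀ z₁ z₂ z₃ : Circle, z₁ ≠ z₃ →
      Ψ z₁ z₂ z₃ = (D z₁ z₂ - D z₂ z₃) / ((z₁ : ℂ) - z₃) :=
    fun z₁ z₂ z₃ h => by rw [← h2, mul_div_cancel_left₀ _ (Circle.coe_sub_ne_zero h)]
  refine ⟨Ψ, ⟨D, ⟨q1, fun z => ?_⟩, q2, fun z₁ z₂ => ?_⟩, hΨ.memProjectiveTensor₃⟩
  · refine (((hD z).tendsto z).mono_left nhdsWithin_le_nhds).congr' ?_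
    filter_upwards [self_mem_nhdsWithin] with u hu using q1 z u (Ne.symm hu)
  · refine (((hΨ.continuous z₁ z₂).tendsto z₁).mono_left nhdsWithin_le_nhds).congr' ?_
    filter_upwards [self_mem_nhdsWithin] with u hu using q2 z₁ z₂ u (Ne.symm hu)

theorem const (c : ℂ) : HasDivDiffBound (fun _ => c) 0 :=
  ⟨fun _ _ => 0, fun _ _ _ => 0, fun _ => continuous_const, by simp, by simp,
    ProjTensorBound.zero⟩

theorem add {f g : Circle → ℂ} {C C' : ℝ} (hf : HasDivDiffBound f C)
    (hg : HasDivDiffBound g C') : HasDivDiffBound (fun z => f z + g z) (C + C') := by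
  obtain ⟨D, Ψ, hD, h1, h2, hΨ⟩ := hf
  obtain ⟨D', Ψ', hD', h1', h2', hΨ'⟩ := hg
  refine ⟨fun x y => D x y + D' x y, _, fun z => (hD z).add (hD' z), fun x y => ?_,
    fun x y z => ?_, hΨ.add hΨ'⟩
  · rw [mul_add, h1, h1']; ring
  · rw [mul_add, h2, h2']; ring

/-- Compare with the antipode `y' = -y`: there the denominator has modulus `2`, so `‖D y y'‖ ≤ B`,
while `D x y - D y y' = (x - y') Ψ x y y'` costs at most `2 * C`. This makes the series of first
divided differences converge uniformly. -/
theorem norm_le_of_identities {f : Circle → ℂ} {B C : ℝ} {D : Circle → Circle → ℂ}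
    {Ψ : Circle → Circle → Circle → ℂ} (hB : ∀ z, ‖f z‖ ≤ B)
    (h1 : ∀ z₁ z₂ : Circle, ((z₁ : ℂ) - z₂) * D z₁ z₂ = f z₁ - f z₂)
    (h2 : ∀ z₁ z₂ z₃ : Circle, ((z₁ : ℂ) - z₃) * Ψ z₁ z₂ z₃ = D z₁ z₂ - D z₂ z₃)
    (hC : ∀ z₁ z₂ z₃, ‖Ψ z₁ z₂ z₃‖ ≤ C) (x y : Circle) : ‖D x y‖ ≤ B + 2 * C := by
  obtain ⟨y', hy'⟩ : ∃ y' : Circle, (y' : ℂ) = -y :=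
    ⟨Circle.exp Real.pi * y, by simp [Circle.coe_exp]⟩
  have e1 : 2 * ‖D y y'‖ ≤ 2 * B := by
    have := congrArg norm (h1 y y')
    rw [hy', sub_neg_eq_add, ← two_mul, norm_mul, norm_mul, Circle.norm_coe] at this
    have h3 := norm_sub_le (f y) (f y')
    have h4 := hB y
    have h5 := hB y'
    simp only [Complex.norm_ofNat, mul_one] at this
    linarith
  have e2 : ‖D x y - D y y'‖ ≤ 2 * C := by
    rw [← h2, norm_mul]
    refine mul_le_mul ?_ (hC _ _ _) (norm_nonneg _) (by norm_num)
    refine (norm_sub_le _ _).trans ?_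
    rw [Circle.norm_coe, Circle.norm_coe]; norm_num
  have e3 := norm_sub_norm_le (D x y) (D y y')
  linarith

theorem tsum {κ : Type} [Countable κ] {f : κ → Circle → ℂ} {B C : κ → ℝ}
    (hf : ∀ n, HasDivDiffBound (f n) (C n)) (hfB : ∀ n z, ‖f n z‖ ≤ B n)
    (hB : Summable B) (hC : Summable C) :
    HasDivDiffBound (fun z => ∑' n, f n z) (∑' n, C n) := by
  choose D Ψ hD h1 h2 hΨ using hf
  have hDB : ∀ n x y, ‖D n x y‖ ≤ B n + 2 * C n := fun n x y =>
    norm_le_of_identities (hfB n) (h1 n) (h2 n) (hΨ n).norm_le x y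
  have hDs : Summable fun n => B n + 2 * C n := hB.add (hC.mul_left 2)
  have sf : ∀ z, Summable fun n => f n z := fun z =>
    Summable.of_norm_bounded hB fun n => hfB n z
  have sD : ∀ x y, Summable fun n => D n x y := fun x y =>
    Summable.of_norm_bounded hDs fun n => hDB n x y
  refine ⟨fun x y => ∑' n, D n x y, _, fun z => ?_, fun x y => ?_, fun x y z => ?_,
    ProjTensorBound.tsum hΨ hC⟩
  · exact continuous_tsum (fun n => hD n z) hDs fun n y => hDB n z y
  · rw [← tsum_mul_left, ← (sf x).tsum_sub (sf y)]
    exact tsum_congr fun n => h1 n x y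
  · rw [← tsum_mul_left, ← (sD x y).tsum_sub (sD y z)]
    exact tsum_congr fun n => h2 n x y z

end HasDivDiffBound

/-! ### Hankel forms and divided differences of polynomials -/

/-- Multiplying by `x` or by `z` shifts one index, turning both products into the same double sum up
to boundary terms. The upper boundary vanishes by `hb`; the lower ones give the right-hand side. -/
theorem sub_mul_sum_sum_eq {R : Type*} [CommRing R] {b : ℕ → R} {M : ℕ}
    (hb : ∀ m, M ≤ m → b m = 0) (x z : R) :
    (x - z) * ∑ i ∈ Finset.range M, ∑ k ∈ Finset.range M, b (i + k + 1) * x ^ i * z ^ k =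
      ∑ i ∈ Finset.range M, b i * x ^ i - ∑ k ∈ Finset.range M, b k * z ^ k := by
  have h1 : x * ∑ i ∈ Finset.range M, ∑ k ∈ Finset.range M, b (i + k + 1) * x ^ i * z ^ k =
      ∑ k ∈ Finset.range M, ∑ i ∈ Finset.range M, b (i + k) * x ^ i * z ^ k -
        ∑ k ∈ Finset.range M, b k * z ^ k := by
    rw [Finset.sum_comm, Finset.mul_sum, ← Finset.sum_sub_distrib]
    refine Finset.sum_congr rfl fun k _ => ?_
    have h := Finset.sum_range_succ' (fun i => b (i + k) * x ^ i * z ^ k) M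
    rw [Finset.sum_range_succ, hb (M + k) (by omega)] at h
    rw [Finset.mul_sum, eq_sub_iff_add_eq]
    simp only [zero_mul, add_zero, zero_add, pow_zero, mul_one] at h
    rw [h]
    congr 1
    refine Finset.sum_congr rfl fun i _ => ?_
    rw [add_right_comm i 1 k]; ring
  have h2 : z * ∑ i ∈ Finset.range M, ∑ k ∈ Finset.range M, b (i + k + 1) * x ^ i * z ^ k =
      ∑ i ∈ Finset.range M, ∑ k ∈ Finset.range M, b (i + k) * x ^ i * z ^ k -
        ∑ i ∈ Finset.range M, b i * x ^ i := by
    rw [Finset.mul_sum, ← Finset.sum_sub_distrib]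
    refine Finset.sum_congr rfl fun i _ => ?_
    have h := Finset.sum_range_succ' (fun k => b (i + k) * x ^ i * z ^ k) M
    rw [Finset.sum_range_succ, hb (i + M) (by omega)] at h
    rw [Finset.mul_sum, eq_sub_iff_add_eq]
    simp only [zero_mul, add_zero, pow_zero, mul_one] at h
    rw [h]
    congr 1
    refine Finset.sum_congr rfl fun k _ => ?_
    rw [← add_assoc i k 1]; ring
  rw [sub_mul, h1, h2, Finset.sum_comm]
  ring

/-- The trilinear form `∑ a (i + j + k + c) x^i y^j z^k`, the sum being over `i, j, k < M`. -/
def hankelForm {R : Type*} [CommRing R] (a : ℕ → R) (M c : ℕ) (x y z : R) : R :=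
  ∑ j ∈ Finset.range M, ∑ i ∈ Finset.range M, ∑ k ∈ Finset.range M,
    a (i + j + k + c) * x ^ i * y ^ j * z ^ k

theorem sub_mul_hankelForm {R : Type*} [CommRing R] {a : ℕ → R} {M : ℕ}
    (ha : ∀ m, M ≤ m → a m = 0) (c : ℕ) (x y z : R) :
    (x - z) * hankelForm a M (c + 1) x y z =
      ∑ j ∈ Finset.range M, y ^ j * (∑ i ∈ Finset.range M, a (i + j + c) * x ^ i -
        ∑ i ∈ Finset.range M, a (i + j + c) * z ^ i) := by
  rw [hankelForm, Finset.mul_sum]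
  refine Finset.sum_congr rfl fun j _ => ?_
  rw [← sub_mul_sum_sum_eq (b := fun m => a (m + j + c)) fun m hm => ha _ (by omega)]
  rw [mul_left_comm]
  congr 1
  simp only [Finset.mul_sum]
  refine Finset.sum_congr rfl fun i _ => Finset.sum_congr rfl fun k _ => ?_
  rw [show i + j + k + (c + 1) = i + k + 1 + j + c by ring]
  ring

/-- The coordinate function `z ↦ z` on the circle. -/
def coordMap : C(Circle, ℂ) := ⟨fun z => (z : ℂ), by fun_prop⟩

@[simp] theorem coordMap_apply (z : Circle) : coordMap z = (z : ℂ) := rfl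

theorem norm_coordMap_pow_le (n : ℕ) : ‖coordMap ^ n‖ ≤ 1 :=
  (ContinuousMap.norm_le _ zero_le_one).2 fun z => by simp [Circle.norm_coe]

/-- Three partial sums, each over `M ^ 2` elementary tensors of norm at most `B`, arise from
assigning each coefficient to the indices at which `h` equals `1`. -/
theorem projTensorBound_hankelForm {a : ℕ → ℂ} {M c : ℕ} {h : ℕ → ℝ} {B : ℝ}
    (h0 : ∀ i, 0 ≤ h i) (h1 : ∀ i, h i ≤ 1)
    (ha : ∀ i < M, ∀ j < M, ∀ k < M,
      a (i + j + k + c) ≠ 0 → h i = 1 ∨ h j = 1 ∨ h k = 1)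
    (hB : ∀ (s : ℕ) (z : Circle),
      ‖∑ i ∈ Finset.range M, (h i : ℂ) * a (i + s + c) * (z : ℂ) ^ i‖ ≤ B) :
    ProjTensorBound (fun x y z => hankelForm a M c (x : ℂ) y z) (3 * M ^ 2 * B) := by
  have hB0 : 0 ≤ B := (norm_nonneg _).trans (hB 0 1)
  let T : ℕ → C(Circle, ℂ) := fun s =>
    ∑ i ∈ Finset.range M, ((h i : ℂ) * a (i + s + c)) • coordMap ^ i
  have hTapp : ∀ s z, T s z =
      ∑ i ∈ Finset.range M, (h i : ℂ) * a (i + s + c) * (z : ℂ) ^ i := fun s z => by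
    simp [T, ContinuousMap.sum_apply]
  have hT : ∀ s, ‖T s‖ ≤ B := fun s =>
    (ContinuousMap.norm_le _ hB0).2 fun z => by rw [hTapp]; exact hB s z
  let E : ℕ → C(Circle, ℂ) := fun i => (1 - (h i : ℂ)) • coordMap ^ i
  have hE : ∀ i, ‖E i‖ ≤ 1 := fun i => by
    rw [norm_smul]
    refine mul_le_one₀ ?_ (norm_nonneg _) (norm_coordMap_pow_le i)
    rw [← Complex.ofReal_one, ← Complex.ofReal_sub, Complex.norm_real, Real.norm_eq_abs, abs_le]
    constructor <;> linarith [h0 i, h1 i]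
  have bound : ∀ f g k : C(Circle, ℂ), ‖f‖ ≤ 1 → ‖g‖ ≤ 1 → ‖k‖ ≤ B →
      ‖f‖ * ‖g‖ * ‖k‖ ≤ B := fun f g k hf hg hk =>
    (mul_le_of_le_one_left (norm_nonneg _) (mul_le_one₀ hf (norm_nonneg _) hg)).trans hk
  have s1 := ProjTensorBound.sum (Finset.range M) fun j _ =>
    ProjTensorBound.sum (Finset.range M) fun k _ =>
      (ProjTensorBound.pure (T (j + k)) (coordMap ^ j) (coordMap ^ k)).mono
        ((by ring : _ = ‖coordMap ^ j‖ * ‖coordMap ^ k‖ * ‖T (j + k)‖).trans_le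
          (bound _ _ _ (norm_coordMap_pow_le j) (norm_coordMap_pow_le k) (hT (j + k))))
  have s2 := ProjTensorBound.sum (Finset.range M) fun i _ =>
    ProjTensorBound.sum (Finset.range M) fun k _ =>
      (ProjTensorBound.pure (E i) (T (i + k)) (coordMap ^ k)).mono
        ((by ring : _ = ‖E i‖ * ‖coordMap ^ k‖ * ‖T (i + k)‖).trans_le
          (bound _ _ _ (hE i) (norm_coordMap_pow_le k) (hT (i + k))))
  have s3 := ProjTensorBound.sum (Finset.range M) fun j _ =>
    ProjTensorBound.sum (Finset.range M) fun i _ =>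
      (ProjTensorBound.pure (E i) (E j) (T (i + j))).mono
        (bound _ _ _ (hE i) (hE j) (hT (i + j)))
  convert (s1.add s2).add s3 using 1
  · funext x y z
    have e1 : ∑ j ∈ Finset.range M, ∑ k ∈ Finset.range M,
        T (j + k) x * (coordMap ^ j) y * (coordMap ^ k) z =
        ∑ j ∈ Finset.range M, ∑ i ∈ Finset.range M, ∑ k ∈ Finset.range M,
          (h i : ℂ) * (a (i + j + k + c) * (x : ℂ) ^ i * (y : ℂ) ^ j * (z : ℂ) ^ k) := by
      refine Finset.sum_congr rfl fun j _ => ?_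
      rw [Finset.sum_comm]
      refine Finset.sum_congr rfl fun k _ => ?_
      rw [hTapp, Finset.sum_mul, Finset.sum_mul]
      refine Finset.sum_congr rfl fun i _ => ?_
      simp only [ContinuousMap.pow_apply, coordMap_apply, ← add_assoc]
      ring
    have e2 : ∑ i ∈ Finset.range M, ∑ k ∈ Finset.range M,
        E i x * T (i + k) y * (coordMap ^ k) z =
        ∑ j ∈ Finset.range M, ∑ i ∈ Finset.range M, ∑ k ∈ Finset.range M,
          (1 - (h i : ℂ)) * h j *
            (a (i + j + k + c) * (x : ℂ) ^ i * (y : ℂ) ^ j * (z : ℂ) ^ k) := by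
      rw [Finset.sum_comm (s := Finset.range M) (t := Finset.range M) (f := fun j i =>
        ∑ k ∈ Finset.range M, (1 - (h i : ℂ)) * h j *
            (a (i + j + k + c) * (x : ℂ) ^ i * (y : ℂ) ^ j * (z : ℂ) ^ k))]
      refine Finset.sum_congr rfl fun i _ => ?_
      rw [Finset.sum_comm]
      refine Finset.sum_congr rfl fun k _ => ?_
      rw [hTapp, Finset.mul_sum, Finset.sum_mul]
      refine Finset.sum_congr rfl fun j _ => ?_
      simp only [E, ContinuousMap.smul_apply, ContinuousMap.pow_apply, coordMap_apply, smul_eq_mul]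
      rw [show j + (i + k) + c = i + j + k + c by ring]
      ring
    have e3 : ∑ j ∈ Finset.range M, ∑ i ∈ Finset.range M,
        E i x * E j y * T (i + j) z =
        ∑ j ∈ Finset.range M, ∑ i ∈ Finset.range M, ∑ k ∈ Finset.range M,
          (1 - (h i : ℂ)) * (1 - h j) * h k *
            (a (i + j + k + c) * (x : ℂ) ^ i * (y : ℂ) ^ j * (z : ℂ) ^ k) := by
      refine Finset.sum_congr rfl fun j _ => Finset.sum_congr rfl fun i _ => ?_
      rw [hTapp, Finset.mul_sum]
      refine Finset.sum_congr rfl fun k _ => ?_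
      simp only [E, ContinuousMap.smul_apply, ContinuousMap.pow_apply, coordMap_apply, smul_eq_mul]
      rw [show k + (i + j) + c = i + j + k + c by ring]
      ring
    rw [e1, e2, e3, hankelForm]
    simp only [← Finset.sum_add_distrib]
    refine Finset.sum_congr rfl fun j hj => Finset.sum_congr rfl fun i hi =>
      Finset.sum_congr rfl fun k hk => ?_
    rw [Finset.mem_range] at hi hj hk
    by_cases h0 : a (i + j + k + c) = 0
    · simp [h0]
    -- The three weights add up to `1 - (1 - h i) * (1 - h j) * (1 - h k)`, which is `1` as soon as
    -- one of the values is `1`.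
    · rcases ha i hi j hj k hk h0 with h | h | h <;> rw [h] <;> push_cast <;> ring
  · rw [Finset.card_range]; ring

theorem hasDivDiffBound_polynomial {a : ℕ → ℂ} {M : ℕ} {C : ℝ} (ha : ∀ m, M ≤ m → a m = 0)
    (hC : ProjTensorBound (fun x y z => hankelForm a M 2 (x : ℂ) y z) C) :
    HasDivDiffBound (fun z => ∑ m ∈ Finset.range M, a m * (z : ℂ) ^ m) C := by
  refine ⟨fun x y => ∑ i ∈ Finset.range M, ∑ k ∈ Finset.range M,
    a (i + k + 1) * (x : ℂ) ^ i * (y : ℂ) ^ k, _, fun z => by fun_prop,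
    fun x y => sub_mul_sum_sum_eq ha _ _, fun x y z => ?_, hC⟩
  rw [sub_mul_hankelForm ha]
  simp only [mul_sub, Finset.sum_sub_distrib, Finset.mul_sum]
  congr 1
  · rw [Finset.sum_comm]
    exact Finset.sum_congr rfl fun i _ => Finset.sum_congr rfl fun j _ => by ring
  · exact Finset.sum_congr rfl fun i _ => Finset.sum_congr rfl fun j _ => by
      rw [add_comm i j]; ring

/-- From `x - y = -x y (x⁻¹ - y⁻¹)`, each division contributes inverse weights. The shift is `1`
instead of `2` because the weight of `y` occurs in both first differences and only the outer
variables keep an extra factor. -/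
theorem hasDivDiffBound_polynomial_inv {a : ℕ → ℂ} {M : ℕ} {C : ℝ} (ha : ∀ m, M ≤ m → a m = 0)
    (hC : ProjTensorBound (fun x y z => hankelForm a M 1 (x : ℂ) y z) C) :
    HasDivDiffBound (fun z => ∑ m ∈ Finset.range M, a m * ((z⁻¹ : Circle) : ℂ) ^ m) C := by
  let ι : C(Circle, Circle) := ⟨fun z => z⁻¹, continuous_inv⟩
  have hinv : ∀ z : Circle, (z : ℂ) * ((z⁻¹ : Circle) : ℂ) = 1 := fun z => by
    rw [← Circle.coe_mul, mul_inv_cancel, Circle.coe_one]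
  have hp : ‖coordMap.comp ι‖ ≤ 1 :=
    (ContinuousMap.norm_le _ zero_le_one).2 fun z => (Circle.norm_coe _).le
  have hdiff : ∀ x y : Circle, ((x : ℂ) - y) * ((x⁻¹ : Circle) * (y⁻¹ : Circle)) =
      -(((x⁻¹ : Circle) : ℂ) - (y⁻¹ : Circle)) := fun x y => by
    linear_combination ((y⁻¹ : Circle) : ℂ) * hinv x - ((x⁻¹ : Circle) : ℂ) * hinv y
  refine ⟨fun x y => -((x⁻¹ : Circle) * (y⁻¹ : Circle) * ∑ i ∈ Finset.range M,
    ∑ k ∈ Finset.range M, a (i + k + 1) * ((x⁻¹ : Circle) : ℂ) ^ i * ((y⁻¹ : Circle) : ℂ) ^ k), _,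
    fun z => by fun_prop, fun x y => ?_, fun x y z => ?_, hC.weighted_comp _ hp ι⟩
  · rw [← sub_mul_sum_sum_eq ha, mul_neg, ← mul_assoc, hdiff]
    ring
  · have hs := sub_mul_hankelForm ha 0 ((x⁻¹ : Circle) : ℂ) (y⁻¹ : Circle) (z⁻¹ : Circle)
    -- Splitting off the term `i = 0` raises the shift by one at the price of a factor `u`; the
    -- split-off `a j` does not depend on `u` and cancels in the difference.
    have key : ∀ (u : ℂ) (j : ℕ), ∑ i ∈ Finset.range M, a (i + j + 0) * u ^ i =
        u * ∑ i ∈ Finset.range M, a (i + j + 1) * u ^ i + a j := fun u j => by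
      have h := Finset.sum_range_succ' (fun i => a (i + j + 0) * u ^ i) M
      rw [Finset.sum_range_succ, ha (M + j + 0) (by omega)] at h
      simp only [zero_mul, add_zero, zero_add, pow_zero, mul_one] at h
      simp only [add_zero]
      rw [h, Finset.mul_sum]
      congr 1
      refine Finset.sum_congr rfl fun i _ => ?_
      rw [add_right_comm i 1 j]; ring
    simp only [key, add_sub_add_right_eq_sub] at hs
    change ((x : ℂ) - z) * ((x⁻¹ : Circle) * (y⁻¹ : Circle) * (z⁻¹ : Circle) *
      hankelForm a M 1 ((x⁻¹ : Circle) : ℂ) (y⁻¹ : Circle) (z⁻¹ : Circle)) = _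
    have hx : ∑ i ∈ Finset.range M, ∑ k ∈ Finset.range M, a (i + k + 1) *
        ((x⁻¹ : Circle) : ℂ) ^ i * ((y⁻¹ : Circle) : ℂ) ^ k = ∑ j ∈ Finset.range M,
        ((y⁻¹ : Circle) : ℂ) ^ j * ∑ i ∈ Finset.range M,
          a (i + j + 1) * ((x⁻¹ : Circle) : ℂ) ^ i := by
      simp only [Finset.mul_sum]
      rw [Finset.sum_comm]
      exact Finset.sum_congr rfl fun i _ => Finset.sum_congr rfl fun j _ => by ring
    have hz : ∑ i ∈ Finset.range M, ∑ k ∈ Finset.range M, a (i + k + 1) *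
        ((y⁻¹ : Circle) : ℂ) ^ i * ((z⁻¹ : Circle) : ℂ) ^ k = ∑ j ∈ Finset.range M,
        ((y⁻¹ : Circle) : ℂ) ^ j * ∑ i ∈ Finset.range M,
          a (i + j + 1) * ((z⁻¹ : Circle) : ℂ) ^ i := by
      simp only [Finset.mul_sum]
      exact Finset.sum_congr rfl fun i _ => Finset.sum_congr rfl fun j _ => by
        rw [add_comm i j]; ring
    beta_reduce
    rw [hx, hz]
    have hs' : (((x⁻¹ : Circle) : ℂ) - (z⁻¹ : Circle)) *
        hankelForm a M 1 ((x⁻¹ : Circle) : ℂ) (y⁻¹ : Circle) (z⁻¹ : Circle) =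
        (x⁻¹ : Circle) * ∑ j ∈ Finset.range M, ((y⁻¹ : Circle) : ℂ) ^ j *
          ∑ i ∈ Finset.range M, a (i + j + 1) * ((x⁻¹ : Circle) : ℂ) ^ i -
        (z⁻¹ : Circle) * ∑ j ∈ Finset.range M, ((y⁻¹ : Circle) : ℂ) ^ j *
          ∑ i ∈ Finset.range M, a (i + j + 1) * ((z⁻¹ : Circle) : ℂ) ^ i := by
      rw [zero_add] at hs
      rw [hs, Finset.mul_sum, Finset.mul_sum, ← Finset.sum_sub_distrib]
      exact Finset.sum_congr rfl fun j _ => by ring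
    linear_combination ((y⁻¹ : Circle) : ℂ) *
      hankelForm a M 1 ((x⁻¹ : Circle) : ℂ) (y⁻¹ : Circle) (z⁻¹ : Circle) * hdiff x z -
      ((y⁻¹ : Circle) : ℂ) * hs'

/-! ### Fourier analysis on the circle -/

theorem continuous_coe_zpow (k : ℤ) : Continuous fun τ : Circle => (τ : ℂ) ^ k :=
  (by fun_prop : Continuous fun τ : Circle => (τ : ℂ)).zpow₀ k fun τ => Or.inl τ.coe_ne_zero

theorem norm_coe_zpow (τ : Circle) (k : ℤ) : ‖(τ : ℂ) ^ k‖ = 1 := by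
  rw [norm_zpow, Circle.norm_coe, one_zpow]

theorem integrable_of_continuous {F : Circle → ℂ} (hF : Continuous F) :
    Integrable F arcMeasure :=
  hF.integrable_of_hasCompactSupport (HasCompactSupport.of_compactSpace F)

theorem integral_arcMeasure (F : Circle → ℂ) :
    ∫ τ, F τ ∂arcMeasure =
      ∫ x : UnitAddCircle, F (AddCircle.toCircle x) ∂AddCircle.haarAddCircle := by
  have h : (AddCircle.toCircle : UnitAddCircle → Circle) =
      (AddCircle.homeomorphCircle one_ne_zero).toMeasurableEquiv := by
    funext x
    exact (AddCircle.homeomorphCircle_apply one_ne_zero x).symm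
  rw [arcMeasure, h, integral_map_equiv]

theorem fourier_eq_zpow (k : ℤ) (x : UnitAddCircle) :
    fourier k x = ((AddCircle.toCircle x : Circle) : ℂ) ^ k := by
  rw [fourier_apply, AddCircle.toCircle_zsmul, Circle.coe_zpow]

theorem integral_coe_zpow (k : ℤ) :
    ∫ τ : Circle, (τ : ℂ) ^ k ∂arcMeasure = if k = 0 then 1 else 0 := by
  rw [integral_arcMeasure]
  split_ifs with h
  · simp [h]
  · simp_rw [← fourier_eq_zpow]
    exact integral_eq_zero_of_add_right_eq_neg (μ := AddCircle.haarAddCircle)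
      (fourier_add_half_inv_index h one_pos)

instance isOpenPosMeasure_arcMeasure : arcMeasure.IsOpenPosMeasure :=
  AddCircle.continuous_toCircle.isOpenPosMeasure_map fun z =>
    ⟨(AddCircle.homeomorphCircle one_ne_zero).symm z, by
      rw [← AddCircle.homeomorphCircle_apply one_ne_zero, Homeomorph.apply_symm_apply]⟩

/-- The bound holds on a closed set of full measure, which is the whole circle because nonempty open
sets have positive measure. -/
theorem norm_le_toReal_eLpNorm_top {F : Circle → ℂ} (hF : Continuous F)
    (h : eLpNorm F ⊤ arcMeasure ≠ ⊤) (z : Circle) :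
    ‖F z‖ ≤ (eLpNorm F ⊤ arcMeasure).toReal := by
  have hae : ∀ᵐ z ∂arcMeasure, ‖F z‖ ≤ (eLpNorm F ⊤ arcMeasure).toReal := by
    rw [eLpNorm_exponent_top] at h ⊢
    filter_upwards [ae_le_eLpNormEssSup (f := F) (μ := arcMeasure)] with z hz
    rw [← toReal_enorm]
    exact ENNReal.toReal_mono h hz
  have hcl : IsClosed {z | ‖F z‖ ≤ (eLpNorm F ⊤ arcMeasure).toReal} :=
    isClosed_le hF.norm continuous_const
  have := (hcl.ae_eq_univ_iff_eq (μ := arcMeasure)).1 (eventuallyEq_univ.2 hae)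
  exact Set.eq_univ_iff_forall.1 this z

/-- Integration against `f` is a continuous functional on `C(𝕋)` that kills the characters, hence
everything by density. In particular it kills smooth test functions, which determine `f` almost
everywhere. -/
theorem ae_eq_zero_of_integral_zpow_eq_zero {f : Circle → ℂ} (hf : Integrable f arcMeasure)
    (h : ∀ k : ℤ, ∫ τ : Circle, f τ * (τ : ℂ) ^ k ∂arcMeasure = 0) : f =ᵐ[arcMeasure] 0 := by
  have hemb : MeasurableEmbedding (AddCircle.toCircle : UnitAddCircle → Circle) := by
    have h : (AddCircle.toCircle : UnitAddCircle → Circle) =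
        (AddCircle.homeomorphCircle one_ne_zero) :=
      funext fun x => (AddCircle.homeomorphCircle_apply one_ne_zero x).symm
    rw [h]
    exact (AddCircle.homeomorphCircle one_ne_zero).measurableEmbedding
  have hF : Integrable (fun x : UnitAddCircle => f (AddCircle.toCircle x))
      AddCircle.haarAddCircle := (hemb.integrable_map_iff).1 hf
  have hint : ∀ g : C(UnitAddCircle, ℂ), Integrable
      (fun x : UnitAddCircle => f (AddCircle.toCircle x) * g x) AddCircle.haarAddCircle :=
    fun g => hF.mul_bdd (c := ‖g‖) g.continuous.aestronglyMeasurable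
      (Eventually.of_forall fun x => g.norm_coe_le_norm x)
  let Λ : C(UnitAddCircle, ℂ) →L[ℂ] ℂ := LinearMap.mkContinuous
    { toFun := fun g =>
        ∫ x : UnitAddCircle, f (AddCircle.toCircle x) * g x ∂AddCircle.haarAddCircle
      map_add' := fun g k => by
        simp only [ContinuousMap.add_apply, mul_add]
        exact integral_add (hint g) (hint k)
      map_smul' := fun c g => by
        simp only [ContinuousMap.smul_apply, smul_eq_mul, mul_left_comm, integral_const_mul,
          RingHom.id_apply] }
    (∫ x : UnitAddCircle, ‖f (AddCircle.toCircle x)‖ ∂AddCircle.haarAddCircle) fun g => by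
      rw [← integral_mul_const]
      refine norm_integral_le_of_norm_le (hF.norm.mul_const _) (Eventually.of_forall fun x => ?_)
      rw [norm_mul]
      exact mul_le_mul_of_nonneg_left (g.norm_coe_le_norm x) (norm_nonneg _)
  have hΛ : Λ = 0 := by
    refine ContinuousLinearMap.ext_on
      (Submodule.dense_iff_topologicalClosure_eq_top.2 span_fourier_closure_eq_top) ?_
    rintro _ ⟨k, rfl⟩
    change ∫ x : UnitAddCircle, f (AddCircle.toCircle x) * fourier k x ∂AddCircle.haarAddCircle = 0
    simp_rw [fourier_eq_zpow]
    rw [← h k, integral_arcMeasure]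
  have : IsManifold (modelWithCornersSelf ℝ (EuclideanSpace ℝ (Fin 1))) ∞ Circle :=
    IsManifold.of_le (n := ω) le_top
  refine ae_eq_zero_of_integral_contMDiff_smul_eq_zero
    (modelWithCornersSelf ℝ (EuclideanSpace ℝ (Fin 1))) hf.locallyIntegrable fun g hg _ => ?_
  rw [integral_arcMeasure]
  have h0 := DFunLike.congr_fun hΛ ⟨fun x : UnitAddCircle => ((g (AddCircle.toCircle x) : ℝ) : ℂ),
    Complex.continuous_ofReal.comp (hg.continuous.comp AddCircle.continuous_toCircle)⟩
  refine Eq.trans ?_ h0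
  refine integral_congr_ae (Eventually.of_forall fun x => ?_)
  simp [mul_comm]

/-! ### The ramp multiplier in sup norm -/

theorem integral_norm_sq_sum (w : ℕ → ℂ) (n : ℕ) :
    ∫ τ : Circle, ‖∑ p ∈ Finset.range n, w p * (τ : ℂ) ^ (-(p : ℤ))‖ ^ 2 ∂arcMeasure =
      ∑ p ∈ Finset.range n, ‖w p‖ ^ 2 := by
  have key : ∀ τ : Circle,
      ((‖∑ p ∈ Finset.range n, w p * (τ : ℂ) ^ (-(p : ℤ))‖ ^ 2 : ℝ) : ℂ) =
      ∑ p ∈ Finset.range n, ∑ q ∈ Finset.range n,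
        w p * conj (w q) * (τ : ℂ) ^ ((q : ℤ) - p) := fun τ => by
    push_cast
    rw [← Complex.mul_conj', map_sum, Finset.sum_mul_sum]
    refine Finset.sum_congr rfl fun p _ => Finset.sum_congr rfl fun q _ => ?_
    rw [map_mul, map_zpow₀, ← Circle.coe_inv_eq_conj, Circle.coe_inv, inv_zpow', neg_neg,
      sub_eq_neg_add, zpow_add₀ τ.coe_ne_zero]
    ring
  apply Complex.ofReal_injective
  refine integral_complex_ofReal.symm.trans ?_
  rw [integral_congr_ae (Eventually.of_forall key)]
  rw [integral_finsetSum _ fun p _ => integrable_finsetSum _ fun q _ =>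
    (integrable_of_continuous (continuous_coe_zpow _)).const_mul _]
  push_cast
  refine Finset.sum_congr rfl fun p hp => ?_
  rw [integral_finsetSum _ fun q _ =>
    (integrable_of_continuous (continuous_coe_zpow _)).const_mul _]
  simp_rw [integral_const_mul, integral_coe_zpow, sub_eq_zero, Nat.cast_inj]
  simp [← Complex.mul_conj', Finset.mem_range.1 hp]

/-- The linear ramp `i ↦ #{p < L : p ≤ i} / L`, which equals `1` from `L - 1` on. -/
noncomputable def ramp (L i : ℕ) : ℝ := (∑ p ∈ Finset.range L, if p ≤ i then 1 else 0) / L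

theorem ramp_nonneg (L i : ℕ) : 0 ≤ ramp L i :=
  div_nonneg (Finset.sum_nonneg fun p _ => by split_ifs <;> norm_num) L.cast_nonneg

theorem ramp_le_one (L i : ℕ) : ramp L i ≤ 1 := by
  refine div_le_one_of_le₀ ?_ L.cast_nonneg
  refine (Finset.sum_le_sum (g := fun _ => (1 : ℝ)) fun p _ => ?_).trans_eq (by simp)
  split_ifs <;> norm_num

theorem ramp_eq_one {L i : ℕ} (hL : 1 ≤ L) (h : L ≤ i + 1) : ramp L i = 1 := by
  rw [ramp, Finset.sum_congr rfl (g := fun _ => (1 : ℝ)) fun p hp => if_pos ?_]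
  · simp [show (L : ℝ) ≠ 0 by positivity]
  · rw [Finset.mem_range] at hp; omega

/-- An index `i < M` is `p + q` with `p < L` in exactly `L * ramp L i` ways; sums `p + q ≥ M`
contribute nothing by `hG`. -/
theorem sum_sum_add_eq_sum_ramp {G : ℕ → ℂ} {L M : ℕ} (hL : 1 ≤ L) (hG : ∀ i, M ≤ i → G i = 0) :
    ∑ p ∈ Finset.range L, ∑ q ∈ Finset.range M, G (p + q) =
      L * ∑ i ∈ Finset.range M, (ramp L i : ℂ) * G i := by
  have hp : ∀ p, ∑ q ∈ Finset.range M, G (p + q) =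
      ∑ i ∈ Finset.range M, if p ≤ i then G i else 0 := fun p => by
    have e1 : ∑ i ∈ Finset.range M, (if p ≤ i then G i else 0) =
        ∑ i ∈ Finset.range (p + M), if p ≤ i then G i else 0 := by
      refine Finset.sum_subset (fun i hi => ?_) fun i _ hi => ?_
      · rw [Finset.mem_range] at hi ⊢; omega
      · rw [Finset.mem_range, not_lt] at hi
        rw [hG i hi, ite_self]
    rw [e1, Finset.sum_range_add, Finset.sum_eq_zero (s := Finset.range p), zero_add]
    · simp
    · intro i hi
      rw [Finset.mem_range] at hi
      exact if_neg (by omega)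
  have hL' : (L : ℂ) ≠ 0 := by exact_mod_cast (by omega : L ≠ 0)
  simp_rw [hp]
  rw [Finset.sum_comm, Finset.mul_sum]
  refine Finset.sum_congr rfl fun i _ => ?_
  rw [ramp]
  push_cast
  rw [← mul_assoc, mul_div_cancel₀ _ hL', Finset.sum_mul]
  exact Finset.sum_congr rfl fun p _ => by split_ifs <;> simp

/-- Multiplying the coefficients of a shifted trigonometric polynomial by a ramp of length `L`
increases the sup norm by a factor at most `4`, if the degree is at most `16 L`. -/
theorem norm_sum_ramp_mul_le {a : ℕ → ℂ} {L M : ℕ} {B : ℝ} (hL : 1 ≤ L) (hM : M ≤ 16 * L)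
    (ha : ∀ m, M ≤ m → a m = 0)
    (hB : ∀ z : Circle, ‖∑ m ∈ Finset.range M, a m * (z : ℂ) ^ m‖ ≤ B) (e : ℕ) (z : Circle) :
    ‖∑ i ∈ Finset.range M, (ramp L i : ℂ) * a (i + e) * (z : ℂ) ^ i‖ ≤ 4 * B := by
  have hB0 : 0 ≤ B := (norm_nonneg _).trans (hB 1)
  let P : ℕ → Circle → ℂ := fun n τ =>
    ∑ p ∈ Finset.range n, (z : ℂ) ^ p * (τ : ℂ) ^ (-(p : ℤ))
  have hPc : ∀ n, Continuous (P n) := fun n =>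
    continuous_finsetSum _ fun p _ => continuous_const.mul (continuous_coe_zpow _)
  have hP : ∀ n, ∫ τ, ‖P n τ‖ ^ 2 ∂arcMeasure = n := fun n => by
    rw [integral_norm_sq_sum]; simp [Circle.norm_coe]
  have hPi : ∀ n, Integrable (fun τ => ‖P n τ‖ ^ 2) arcMeasure := fun n =>
    ((hPc n).norm.pow 2).integrable_of_hasCompactSupport (HasCompactSupport.of_compactSpace _)
  -- The product of the kernels of lengths `L` and `M` has coefficients counting pairs `p + q = i`,
  -- so integrating it against the polynomial shifted by `e` produces `L` times the ramp sum.
  let F : Circle → ℂ := fun τ =>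
    (∑ m ∈ Finset.range M, a m * (τ : ℂ) ^ m) * (τ : ℂ) ^ (-(e : ℤ)) * P L τ * P M τ
  have hFint : ∫ τ, F τ ∂arcMeasure =
      L * ∑ i ∈ Finset.range M, (ramp L i : ℂ) * a (i + e) * (z : ℂ) ^ i := by
    have h1 : ∀ τ, F τ = ∑ p ∈ Finset.range L, ∑ q ∈ Finset.range M, ∑ m ∈ Finset.range M,
        a m * (z : ℂ) ^ (p + q) * (τ : ℂ) ^ ((m : ℤ) - (p + q + e : ℕ)) := fun τ => by
      simp only [F, P]
      rw [mul_assoc, Finset.sum_mul_sum, Finset.mul_sum]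
      refine Finset.sum_congr rfl fun p _ => ?_
      rw [Finset.mul_sum]
      refine Finset.sum_congr rfl fun q _ => ?_
      rw [Finset.sum_mul, Finset.sum_mul]
      refine Finset.sum_congr rfl fun m _ => ?_
      rw [show (m : ℤ) - (p + q + e : ℕ) = m + (-(e : ℤ)) + -(p : ℤ) + -(q : ℤ) by
        push_cast; ring]
      simp only [zpow_add₀ τ.coe_ne_zero, zpow_natCast, pow_add]
      ring
    have h2 : ∑ i ∈ Finset.range M, (ramp L i : ℂ) * a (i + e) * (z : ℂ) ^ i =
        ∑ i ∈ Finset.range M, (ramp L i : ℂ) * (a (i + e) * (z : ℂ) ^ i) :=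
      Finset.sum_congr rfl fun i _ => mul_assoc _ _ _
    rw [h2, ← sum_sum_add_eq_sum_ramp (G := fun i => a (i + e) * (z : ℂ) ^ i) hL
      fun i hi => by rw [ha _ (by omega), zero_mul]]
    simp_rw [h1]
    have hi : ∀ p q m, Integrable (fun τ : Circle => a m * (z : ℂ) ^ (p + q) *
        (τ : ℂ) ^ ((m : ℤ) - (p + q + e : ℕ))) arcMeasure := fun p q m =>
      (integrable_of_continuous (continuous_coe_zpow _)).const_mul _
    rw [integral_finsetSum _ fun p _ => integrable_finsetSum _ fun q _ =>
      integrable_finsetSum _ fun m _ => hi p q m]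
    refine Finset.sum_congr rfl fun p _ => ?_
    rw [integral_finsetSum _ fun q _ => integrable_finsetSum _ fun m _ => hi p q m]
    refine Finset.sum_congr rfl fun q _ => ?_
    rw [integral_finsetSum _ fun m _ => hi p q m]
    simp_rw [integral_const_mul, integral_coe_zpow, sub_eq_zero, Nat.cast_inj, mul_ite, mul_one,
      mul_zero]
    rw [Finset.sum_ite_eq']
    split_ifs with h
    · rfl
    · rw [Finset.mem_range, not_lt] at h
      rw [ha _ h, zero_mul]
  have hFle : ∀ τ, ‖F τ‖ ≤ B * (2 * ‖P L τ‖ ^ 2 + ‖P M τ‖ ^ 2 / 8) := fun τ => by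
    simp only [F]
    rw [norm_mul, norm_mul, norm_mul, norm_coe_zpow, mul_one, mul_assoc]
    refine mul_le_mul (hB τ) ?_ (by positivity) hB0
    -- A weighted form of `2uv ≤ u² + v²`, balanced for `M` near `16 * L`: the integral becomes `2 *
    -- L + M / 8 ≤ 4 * L`.
    nlinarith [sq_nonneg (4 * ‖P L τ‖ - ‖P M τ‖)]
  have hnorm : ‖∫ τ, F τ ∂arcMeasure‖ ≤ B * (2 * L + M / 8) := by
    refine (norm_integral_le_of_norm_le ?_ (Eventually.of_forall hFle)).trans_eq ?_
    · exact (((hPi L).const_mul 2).add ((hPi M).div_const 8)).const_mul B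
    · rw [integral_const_mul, integral_add ((hPi L).const_mul 2) ((hPi M).div_const 8),
        integral_const_mul, integral_div, hP, hP]
  have hL0 : (0 : ℝ) < L := by exact_mod_cast hL
  have hM' : (M : ℝ) ≤ 16 * L := by exact_mod_cast hM
  rw [hFint, norm_mul, Complex.norm_natCast] at hnorm
  refine le_of_mul_le_mul_left (hnorm.trans ?_) hL0
  nlinarith

/-! ### The dyadic cutoff -/

namespace IsDyadicCutoff

variable {w : ℝ → ℝ}

theorem eq_zero_of_le (hw : IsDyadicCutoff w) {x : ℝ} (hx : x ≤ 1 / 2) : w x = 0 := by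
  have hcl : IsClosed {x | w x = 0} := isClosed_eq hw.smooth.continuous continuous_const
  have hsub : Set.Iio (1 / 2 : ℝ) ⊆ {x | w x = 0} := fun y hy =>
    image_eq_zero_of_notMem_tsupport fun h => (hw.support_subset h).1.not_gt hy
  have := hcl.closure_subset_iff.2 hsub
  rw [closure_Iio] at this
  exact this hx

theorem eq_zero_of_ge (hw : IsDyadicCutoff w) {x : ℝ} (hx : 2 ≤ x) : w x = 0 := by
  have hcl : IsClosed {x | w x = 0} := isClosed_eq hw.smooth.continuous continuous_const
  have hsub : Set.Ioi (2 : ℝ) ⊆ {x | w x = 0} := fun y hy =>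
    image_eq_zero_of_notMem_tsupport fun h => (hw.support_subset h).2.not_gt hy
  have := hcl.closure_subset_iff.2 hsub
  rw [closure_Ioi] at this
  exact this hx

theorem eq_zero_of_pow_le (hw : IsDyadicCutoff w) {n m : ℕ} (h : 2 ^ (n + 1) ≤ m) :
    w ((m : ℝ) / 2 ^ n) = 0 := by
  refine hw.eq_zero_of_ge ((le_div_iff₀ (by positivity)).2 ?_)
  have : ((2 ^ (n + 1) : ℕ) : ℝ) ≤ m := by exact_mod_cast h
  push_cast at this
  linarith [pow_succ (2 : ℝ) n]

theorem pow_lt_of_ne_zero (hw : IsDyadicCutoff w) {n m : ℕ} (h : w ((m : ℝ) / 2 ^ n) ≠ 0) :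
    2 ^ n < 2 * m := by
  by_contra! hle
  refine h (hw.eq_zero_of_le ((div_le_iff₀ (by positivity)).2 ?_))
  have : ((2 * m : ℕ) : ℝ) ≤ (2 ^ n : ℕ) := by exact_mod_cast hle
  push_cast at this
  linarith

/-- The omitted terms are `w (2 ^ j * x)` with `j ≥ 1`; their arguments are at least `2`, so they
vanish. -/
theorem hasSum_nat (hw : IsDyadicCutoff w) {x : ℝ} (hx : 1 ≤ x) :
    HasSum (fun n : ℕ => w (x / 2 ^ n)) 1 := by
  have hinj : Function.Injective fun n : ℕ => -(n : ℤ) := fun a b h => by simpa using h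
  have h := (hinj.hasSum_iff fun j hj => ?_).2 (hw.sum_eq_one x (by linarith))
  · refine h.congr_fun fun n => ?_
    simp [div_eq_inv_mul]
  · refine hw.eq_zero_of_ge ?_
    have hj1 : 1 ≤ j := by
      by_contra hlt
      exact hj ⟨j.natAbs, by simp only; omega⟩
    have : (2 : ℝ) ^ (1 : ℤ) ≤ 2 ^ j := zpow_le_zpow_right₀ (by norm_num) hj1
    rw [zpow_one] at this
    nlinarith

theorem hasSum_nat_of_nonpos (hw : IsDyadicCutoff w) {x : ℝ} (hx : x ≤ 0) :
    HasSum (fun n : ℕ => w (x / 2 ^ n)) 0 := by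
  refine hasSum_zero.congr_fun fun n => ?_
  refine hw.eq_zero_of_le (le_trans (div_nonpos_of_nonpos_of_nonneg hx (by positivity)) ?_)
  norm_num

end IsDyadicCutoff

/-! ### Dyadic pieces and their bounds -/

/-- The Fourier coefficient `φ̂(k) = ∫ φ(τ) τ^{-k} dm(τ)`. -/
noncomputable def circleCoeff (φ : Circle → ℂ) (k : ℤ) : ℂ :=
  ∫ τ : Circle, φ τ * (τ : ℂ) ^ (-k) ∂arcMeasure

/-- The dyadic piece `∑_{m ≥ 0} w(m / 2^n) φ̂(σ m) z^{σ m}` of `φ`, for a sign `σ = ±1`. -/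
noncomputable def dyadicPiece (w : ℝ → ℝ) (φ : Circle → ℂ) (σ : ℤ) (n : ℕ) : C(Circle, ℂ) where
  toFun z := ∑ m ∈ Finset.range (2 ^ (n + 1)),
    (w ((m : ℝ) / 2 ^ n) : ℂ) * circleCoeff φ (σ * m) * (z : ℂ) ^ (σ * m)
  continuous_toFun := continuous_finsetSum _ fun _ _ =>
    continuous_const.mul (continuous_coe_zpow _)

theorem dyadicPiece_apply (w : ℝ → ℝ) (φ : Circle → ℂ) (σ : ℤ) (n : ℕ) (z : Circle) :
    dyadicPiece w φ σ n z = ∑ m ∈ Finset.range (2 ^ (n + 1)),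
      (w ((m : ℝ) / 2 ^ n) : ℂ) * circleCoeff φ (σ * m) * (z : ℂ) ^ (σ * m) := rfl

section

variable {w : ℝ → ℝ} {φ : Circle → ℂ}

theorem integrable_mul_coe_zpow (hφ : Integrable φ arcMeasure) (k : ℤ) :
    Integrable (fun τ : Circle => φ τ * (τ : ℂ) ^ k) arcMeasure :=
  hφ.mul_bdd (c := 1) (continuous_coe_zpow k).aestronglyMeasurable
    (Eventually.of_forall fun τ => (norm_coe_zpow τ k).le)

theorem dyadicKernel_eq_sum (hw : IsDyadicCutoff w) {n : ℕ} (hn : n ≠ 0) (z : Circle) :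
    dyadicKernel w n z = ∑ m ∈ Finset.range (2 ^ (n + 1)),
      (w ((m : ℝ) / 2 ^ n) : ℂ) * (z : ℂ) ^ (m : ℤ) := by
  rw [dyadicKernel, if_neg hn, tsum_eq_sum (s := (Finset.range (2 ^ (n + 1))).map
    Nat.castEmbedding) fun k hk => ?_, Finset.sum_map]
  · simp
  · rw [show w ((k : ℝ) / 2 ^ n) = 0 from ?_]
    · simp
    rcases lt_or_ge k 0 with h | h
    · refine hw.eq_zero_of_le (le_trans (div_nonpos_of_nonpos_of_nonneg ?_ (by positivity))
        (by norm_num))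
      exact_mod_cast h.le
    · lift k to ℕ using h
      rw [Int.cast_natCast]
      refine hw.eq_zero_of_pow_le ?_
      by_contra! hlt
      exact hk (Finset.mem_map.2 ⟨k, Finset.mem_range.2 hlt, rfl⟩)

theorem circleConv_eq_dyadicPiece (hφ : Integrable φ arcMeasure) {K : Circle → ℂ} {σ : ℤ} {n : ℕ}
    (hK : ∀ z : Circle, K z = ∑ m ∈ Finset.range (2 ^ (n + 1)),
      (w ((m : ℝ) / 2 ^ n) : ℂ) * (z : ℂ) ^ (σ * m)) :
    circleConv φ K = dyadicPiece w φ σ n := by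
  funext z
  have h : ∀ τ : Circle, φ τ * K (z * τ⁻¹) = ∑ m ∈ Finset.range (2 ^ (n + 1)),
      (w ((m : ℝ) / 2 ^ n) : ℂ) * (z : ℂ) ^ (σ * m) * (φ τ * (τ : ℂ) ^ (-(σ * m))) :=
    fun τ => by
    rw [hK, Finset.mul_sum]
    refine Finset.sum_congr rfl fun m _ => ?_
    rw [Circle.coe_mul, Circle.coe_inv, mul_zpow, inv_zpow']
    ring
  rw [circleConv, dyadicPiece_apply]
  simp_rw [h]
  rw [integral_finsetSum _ fun m _ => (integrable_mul_coe_zpow hφ _).const_mul _]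
  refine Finset.sum_congr rfl fun m _ => ?_
  rw [integral_const_mul, circleCoeff]
  ring

theorem circleConv_dyadicKernel (hw : IsDyadicCutoff w) (hφ : Integrable φ arcMeasure) (n : ℕ) :
    circleConv φ (dyadicKernel w (n + 1)) = dyadicPiece w φ 1 (n + 1) :=
  circleConv_eq_dyadicPiece hφ fun z => by
    simp only [one_mul]; exact dyadicKernel_eq_sum hw n.succ_ne_zero z

theorem circleConv_dyadicKernelSharp (hw : IsDyadicCutoff w) (hφ : Integrable φ arcMeasure)
    (n : ℕ) : circleConv φ (dyadicKernelSharp w (n + 1)) = dyadicPiece w φ (-1) (n + 1) :=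
  circleConv_eq_dyadicPiece hφ fun z => by
    rw [dyadicKernelSharp, dyadicKernel_eq_sum hw n.succ_ne_zero, map_sum]
    refine Finset.sum_congr rfl fun m _ => ?_
    rw [map_mul, Complex.conj_ofReal, map_zpow₀, ← Circle.coe_inv_eq_conj, Circle.coe_inv,
      inv_zpow', neg_one_mul]

theorem summable_pow_mul_norm {F : ℕ → C(Circle, ℂ)}
    (h : ∑' n : ℕ, (2 : ℝ≥0∞) ^ ((n + 1) * 2) * eLpNorm (F (n + 1)) ⊤ arcMeasure < ⊤) :
    Summable fun n => (4 : ℝ) ^ n * ‖F n‖ := by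
  -- The term `n = 0` does not affect summability; this matters because `dyadicPiece` at `0` uses
  -- `w` itself and is not `φ * W_0`.
  rw [← summable_nat_add_iff 1]
  refine Summable.of_nonneg_of_le (fun n => by positivity) (fun n => ?_)
    (ENNReal.summable_toReal h.ne)
  have hn := ENNReal.lt_top_of_mul_ne_top_right (ENNReal.ne_top_of_tsum_ne_top h.ne n)
    (by positivity)
  rw [ENNReal.toReal_mul, ENNReal.toReal_pow, ENNReal.toReal_ofNat, mul_comm (n + 1) 2, pow_mul]
  norm_num only
  refine mul_le_mul_of_nonneg_left ?_ (by positivity)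
  exact (ContinuousMap.norm_le _ ENNReal.toReal_nonneg).2
    (norm_le_toReal_eLpNorm_top (F (n + 1)).continuous hn.ne)

theorem summable_dyadicPiece (hw : IsDyadicCutoff w) (hφ : MemBesov w 2 φ) :
    Summable fun n => (4 : ℝ) ^ n * ‖dyadicPiece w φ 1 n‖ := by
  refine summable_pow_mul_norm (lt_of_le_of_lt ?_ hφ.sum_lt_top)
  simp_rw [← circleConv_dyadicKernel hw hφ.integrable]
  exact ENNReal.tsum_comp_le_tsum_of_injective (add_left_injective 1)
    fun n => (2 : ℝ≥0∞) ^ (n * 2) * eLpNorm (circleConv φ (dyadicKernel w n)) ⊤ arcMeasure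

theorem summable_dyadicPiece_neg (hw : IsDyadicCutoff w) (hφ : MemBesov w 2 φ) :
    Summable fun n => (4 : ℝ) ^ n * ‖dyadicPiece w φ (-1) n‖ := by
  refine summable_pow_mul_norm (lt_of_le_of_lt (le_of_eq ?_) hφ.sum_sharp_lt_top)
  simp_rw [← circleConv_dyadicKernelSharp hw hφ.integrable]

theorem projTensorBound_dyadic (hw : IsDyadicCutoff w) (b : ℕ → ℂ) (n : ℕ) {c : ℕ} (hc : c ≤ 2)
    {B : ℝ} (hB : ∀ z : Circle, ‖∑ m ∈ Finset.range (2 ^ (n + 1)),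
      (w ((m : ℝ) / 2 ^ n) : ℂ) * b m * (z : ℂ) ^ m‖ ≤ B) :
    ProjTensorBound (fun x y z => hankelForm (fun m => (w ((m : ℝ) / 2 ^ n) : ℂ) * b m)
      (2 ^ (n + 1)) c (x : ℂ) y z) (48 * (4 ^ n * B)) := by
  -- With `L = 2 ^ n / 8 + 1`, indices all below `L - 1` would give `2 * (i + j + k + c) < 2 ^ n`,
  -- outside the support of the cutoff; yet `L` is large enough for `2 ^ (n + 1) ≤ 16 * L`.
  have hL : 1 ≤ 2 ^ n / 8 + 1 := Nat.le_add_left 1 _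
  have hM : 2 ^ (n + 1) ≤ 16 * (2 ^ n / 8 + 1) := by
    rw [pow_succ]; omega
  refine (projTensorBound_hankelForm (h := ramp (2 ^ n / 8 + 1)) (B := 4 * B) (ramp_nonneg _)
    (ramp_le_one _) (fun i _ j _ k _ hne => ?_) fun s z => ?_).mono (le_of_eq ?_)
  · have hlt := hw.pow_lt_of_ne_zero
      (Complex.ofReal_ne_zero.1 (left_ne_zero_of_mul hne))
    have : 2 ^ n / 8 + 1 ≤ i + 1 ∨ 2 ^ n / 8 + 1 ≤ j + 1 ∨ 2 ^ n / 8 + 1 ≤ k + 1 := by omega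
    exact this.imp (ramp_eq_one hL) (Or.imp (ramp_eq_one hL) (ramp_eq_one hL))
  · simp only [add_assoc _ s c]
    exact norm_sum_ramp_mul_le (a := fun m => (w ((m : ℝ) / 2 ^ n) : ℂ) * b m) hL hM
      (fun m hm => by simp [hw.eq_zero_of_pow_le hm]) hB (s + c) z
  -- The constant is `3 * (2 ^ (n + 1)) ^ 2 * (4 * B)`.
  · push_cast
    rw [← pow_mul, mul_comm, mul_comm (n + 1) 2, pow_mul, pow_succ]
    norm_num
    ring

theorem hasDivDiffBound_dyadicPiece (hw : IsDyadicCutoff w) (n : ℕ) :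
    HasDivDiffBound (dyadicPiece w φ 1 n) (48 * (4 ^ n * ‖dyadicPiece w φ 1 n‖)) := by
  have h : ∀ z : Circle, dyadicPiece w φ 1 n z = ∑ m ∈ Finset.range (2 ^ (n + 1)),
      (w ((m : ℝ) / 2 ^ n) : ℂ) * circleCoeff φ m * (z : ℂ) ^ m := fun z => by
    rw [dyadicPiece_apply]
    simp only [one_mul, zpow_natCast]
  rw [show (dyadicPiece w φ 1 n : Circle → ℂ) = _ from funext h]
  refine hasDivDiffBound_polynomial (a := fun m => (w ((m : ℝ) / 2 ^ n) : ℂ) * circleCoeff φ m)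
    (fun m hm => by simp [hw.eq_zero_of_pow_le hm])
    (projTensorBound_dyadic hw _ n le_rfl fun z => ?_)
  rw [← h]
  exact ContinuousMap.norm_coe_le_norm _ z

theorem hasDivDiffBound_dyadicPiece_neg (hw : IsDyadicCutoff w) (n : ℕ) :
    HasDivDiffBound (dyadicPiece w φ (-1) n) (48 * (4 ^ n * ‖dyadicPiece w φ (-1) n‖)) := by
  have h : ∀ z : Circle, dyadicPiece w φ (-1) n z = ∑ m ∈ Finset.range (2 ^ (n + 1)),
      (w ((m : ℝ) / 2 ^ n) : ℂ) * circleCoeff φ (-m) * ((z⁻¹ : Circle) : ℂ) ^ m := fun z => by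
    rw [dyadicPiece_apply]
    simp only [neg_one_mul, Circle.coe_inv, zpow_neg, zpow_natCast, inv_pow]
  rw [show (dyadicPiece w φ (-1) n : Circle → ℂ) = _ from funext h]
  refine hasDivDiffBound_polynomial_inv
    (a := fun m => (w ((m : ℝ) / 2 ^ n) : ℂ) * circleCoeff φ (-m))
    (fun m hm => by simp [hw.eq_zero_of_pow_le hm])
    (projTensorBound_dyadic hw _ n one_le_two fun z => ?_)
  have hz := h z⁻¹
  rw [inv_inv] at hz
  rw [← hz]
  exact ContinuousMap.norm_coe_le_norm _ _

theorem circleCoeff_dyadicPiece (hw : IsDyadicCutoff w) {σ : ℤ} (hσ : σ = 1 ∨ σ = -1) (n : ℕ)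
    (k : ℤ) : circleCoeff (dyadicPiece w φ σ n) k =
      (w (((σ * k : ℤ) : ℝ) / 2 ^ n) : ℂ) * circleCoeff φ k := by
  have h : ∀ τ : Circle, dyadicPiece w φ σ n τ * (τ : ℂ) ^ (-k) =
      ∑ m ∈ Finset.range (2 ^ (n + 1)), (w ((m : ℝ) / 2 ^ n) : ℂ) * circleCoeff φ (σ * m) *
        (τ : ℂ) ^ (σ * m - k) := fun τ => by
    rw [dyadicPiece_apply, Finset.sum_mul]
    refine Finset.sum_congr rfl fun m _ => ?_
    rw [sub_eq_add_neg, zpow_add₀ τ.coe_ne_zero, mul_assoc]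
  have hσσ : σ * σ = 1 := by rcases hσ with rfl | rfl <;> norm_num
  rw [circleCoeff]
  simp_rw [h]
  rw [integral_finsetSum _ fun m _ =>
    (integrable_of_continuous (continuous_coe_zpow _)).const_mul _]
  simp_rw [integral_const_mul, integral_coe_zpow]
  have hiff : ∀ m : ℕ, σ * m - k = 0 ↔ (m : ℤ) = σ * k := fun m =>
    ⟨fun h => by linear_combination σ * h - (m : ℤ) * hσσ,
      fun h => by linear_combination σ * h + k * hσσ⟩
  simp_rw [hiff]
  -- Frequencies of the wrong sign are absent from the piece, and `w` vanishes at negative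
  -- arguments; otherwise only `m = σ * k` survives.
  rcases lt_or_ge (σ * k) 0 with hneg | hpos
  · rw [Finset.sum_eq_zero fun m _ => by rw [if_neg (by omega), mul_zero],
      hw.eq_zero_of_le (le_trans (div_nonpos_of_nonpos_of_nonneg (by exact_mod_cast hneg.le)
        (by positivity)) (by norm_num))]
    simp
  · obtain ⟨m₀, hm₀⟩ := Int.eq_ofNat_of_zero_le hpos
    have hk : σ * (m₀ : ℤ) = k := by rw [← hm₀, ← mul_assoc, hσσ, one_mul]
    rw [hm₀]
    simp_rw [Nat.cast_inj, mul_ite, mul_one, mul_zero]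
    rw [Finset.sum_ite_eq', hk]
    split_ifs with hmem
    · simp
    · rw [Finset.mem_range, not_lt] at hmem
      rw [Int.cast_natCast, hw.eq_zero_of_pow_le hmem]
      simp

theorem circleCoeff_tsum {F : ℕ → C(Circle, ℂ)} (hF : Summable fun n => ‖F n‖) (k : ℤ) :
    HasSum (fun n => circleCoeff (F n) k) (circleCoeff (fun z => ∑' n, F n z) k) := by
  have h := hasSum_integral_of_summable_integral_norm (μ := arcMeasure)
    (F := fun n (τ : Circle) => F n τ * (τ : ℂ) ^ (-k))
    (fun n => integrable_mul_coe_zpow (integrable_of_continuous (F n).continuous) _) ?_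
  · simpa only [circleCoeff, tsum_mul_right] using h
  · refine Summable.of_nonneg_of_le (fun n => by positivity) (fun n => ?_) hF
    have hle : ∀ τ : Circle, ‖‖F n τ * (τ : ℂ) ^ (-k)‖‖ ≤ ‖F n‖ := fun τ => by
      rw [norm_norm, norm_mul, norm_coe_zpow, mul_one]
      exact (F n).norm_coe_le_norm τ
    exact (le_abs_self _).trans ((norm_integral_le_of_norm_le_const (μ := arcMeasure)
      (Eventually.of_forall hle)).trans_eq (by simp))

theorem circleCoeff_add {f g : Circle → ℂ} (hf : Integrable f arcMeasure)
    (hg : Integrable g arcMeasure) (k : ℤ) :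
    circleCoeff (fun z => f z + g z) k = circleCoeff f k + circleCoeff g k := by
  simp only [circleCoeff, add_mul]
  exact integral_add (integrable_mul_coe_zpow hf _) (integrable_mul_coe_zpow hg _)

theorem circleCoeff_const (c : ℂ) (k : ℤ) :
    circleCoeff (fun _ => c) k = if k = 0 then c else 0 := by
  simp only [circleCoeff, integral_const_mul, integral_coe_zpow, neg_eq_zero, mul_ite, mul_one,
    mul_zero]

theorem ae_eq_of_circleCoeff_eq {f g : Circle → ℂ} (hf : Integrable f arcMeasure)
    (hg : Integrable g arcMeasure) (h : ∀ k, circleCoeff f k = circleCoeff g k) :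
    f =ᵐ[arcMeasure] g := by
  rw [← sub_ae_eq_zero]
  refine ae_eq_zero_of_integral_zpow_eq_zero (hf.sub hg) fun k => ?_
  have hk := h (-k)
  simp only [circleCoeff, neg_neg] at hk
  simp only [Pi.sub_apply, sub_mul]
  rw [integral_sub (integrable_mul_coe_zpow hf _) (integrable_mul_coe_zpow hg _), hk, sub_self]

end

end BesovCircle

/-! ### Reassembling `φ` from its pieces -/

theorem mainTheorem8 (w : ℝ → ℝ) (hw : BesovCircle.IsDyadicCutoff w)
    (φ : Circle → ℂ) (hφ : BesovCircle.MemBesov w 2 φ) :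
    ∃ φ₀ : C(Circle, ℂ), φ =ᵐ[BesovCircle.arcMeasure] φ₀ ∧
      ∃ Ψ : Circle → Circle → Circle → ℂ,
        BesovCircle.IsDividedDifference₂ φ₀ Ψ ∧ BesovCircle.MemProjectiveTensor₃ Ψ := by
  open BesovCircle in
  have summ : ∀ {F : ℕ → C(Circle, ℂ)}, Summable (fun n => (4 : ℝ) ^ n * ‖F n‖) →
      Summable fun n => ‖F n‖ := fun h =>
    Summable.of_nonneg_of_le (fun n => norm_nonneg _)
      (fun n => le_mul_of_one_le_left (norm_nonneg _) (one_le_pow₀ (by norm_num))) h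
  have hp := summable_dyadicPiece hw hφ
  have hn := summable_dyadicPiece_neg hw hφ
  have cont : ∀ {F : ℕ → C(Circle, ℂ)}, Summable (fun n => ‖F n‖) →
      Continuous fun z => ∑' n, F n z := fun h =>
    continuous_tsum (fun n => (_ : C(Circle, ℂ)).continuous) h
      fun n z => ContinuousMap.norm_coe_le_norm _ z
  have cp := cont (summ hp)
  have cn := cont (summ hn)
  -- Only the mean is added separately: the pieces from `n = 0` on already give total weight `1` to
  -- every nonzero frequency, including `±1`.
  let φ₀ : C(Circle, ℂ) := ⟨fun z => circleCoeff φ 0 + ∑' n, dyadicPiece w φ 1 n z +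
    ∑' n, dyadicPiece w φ (-1) n z, (continuous_const.add cp).add cn⟩
  refine ⟨φ₀, ae_eq_of_circleCoeff_eq hφ.integrable (integrable_of_continuous φ₀.continuous)
    fun k => ?_, ?_⟩
  · have h1 : HasSum (fun n => circleCoeff (dyadicPiece w φ 1 n) k)
        (if 1 ≤ k then circleCoeff φ k else 0) := by
      simp_rw [circleCoeff_dyadicPiece hw (Or.inl rfl), one_mul]
      split_ifs with hk
      · simpa using ((Complex.hasSum_ofReal.2 (hw.hasSum_nat (x := k)
          (by exact_mod_cast hk))).mul_right (circleCoeff φ k))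
      · simpa using ((Complex.hasSum_ofReal.2 (hw.hasSum_nat_of_nonpos (x := k)
          (by exact_mod_cast (by omega : k ≤ 0)))).mul_right (circleCoeff φ k))
    have h2 : HasSum (fun n => circleCoeff (dyadicPiece w φ (-1) n) k)
        (if k ≤ -1 then circleCoeff φ k else 0) := by
      simp_rw [circleCoeff_dyadicPiece hw (Or.inr rfl), neg_one_mul]
      split_ifs with hk
      · simpa using ((Complex.hasSum_ofReal.2 (hw.hasSum_nat (x := (-k : ℤ))
          (by exact_mod_cast (by omega : 1 ≤ -k)))).mul_right (circleCoeff φ k))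
      · simpa using ((Complex.hasSum_ofReal.2 (hw.hasSum_nat_of_nonpos (x := (-k : ℤ))
          (by exact_mod_cast (by omega : -k ≤ 0)))).mul_right (circleCoeff φ k))
    change _ = circleCoeff (fun z => circleCoeff φ 0 + ∑' n, dyadicPiece w φ 1 n z +
      ∑' n, dyadicPiece w φ (-1) n z) k
    rw [circleCoeff_add (f := fun z => circleCoeff φ 0 + ∑' n, dyadicPiece w φ 1 n z)
      (integrable_of_continuous (continuous_const.add cp)) (integrable_of_continuous cn),
      circleCoeff_add (integrable_of_continuous continuous_const) (integrable_of_continuous cp), circleCoeff_const,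
      (circleCoeff_tsum (summ hp) k).unique h1, (circleCoeff_tsum (summ hn) k).unique h2]
    rcases lt_trichotomy k 0 with h | rfl | h
    · rw [if_neg h.ne, if_neg (by omega), if_pos (by omega)]; ring
    · simp
    · rw [if_neg h.ne', if_pos (by omega), if_neg (by omega)]; ring
  · exact (((HasDivDiffBound.const (circleCoeff φ 0)).add
      (HasDivDiffBound.tsum (hasDivDiffBound_dyadicPiece hw)
        (fun n z => ContinuousMap.norm_coe_le_norm _ z) (summ hp) (hp.mul_left 48))).add
      (HasDivDiffBound.tsum (hasDivDiffBound_dyadicPiece_neg hw)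
        (fun n z => ContinuousMap.norm_coe_le_norm _ z) (summ hn)
        (hn.mul_left 48))).exists_isDividedDifference₂
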